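/- For a positive integer $n$, an $n$-sided die (in the balanced sequences model) is a sequence $(a_1,\dots,a_n)$ of elements of $\{1,2,\dots,n\}$ with $\sum_i a_i=n(n+1)/2$, and a random $n$-sided die is one chosen uniformly from the finite set of all $n$-sided dice. A die $A=(a_1,\dots,a_n)$ ties with a die $B=(b_1,\dots,b_n)$ if the number of pairs $(i,j)$ with $a_i>b_j$ equals the number of pairs $(i,j)$ with $a_i<b_j$. Theorem. (i) If $A$ and $B$ are independent random $n$-sided dice, then $\mathbb{P}[A\text{ ties with }B]\to 0$ as $n\to\infty$. (ii) There are absolute constants $C_1,C_2>0$ such that for every integer $n\ge 1$ the following holds: for all but at most a fraction $C_1 n^{-5}$ of the $n$-sided dice $A$, the probability that a random $n$-sided die $B$ ties with $A$ is at most $C_2(\log n)^{5/2}/n$. -/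

import Mathlib

open Filter Topology MeasureTheory ProbabilityTheory

/-- The `n`-sided dice of the balanced sequences model: the sequences `(a_1, …, a_n)` of elements of
`{1, …, n}` with sum `n (n + 1) / 2`. -/
def dice (n : ℕ) : Finset (Fin n → ℕ) :=
  (Fintype.piFinset fun _ : Fin n => Finset.Icc 1 n).filter
    fun a => ∑ i, a i = n * (n + 1) / 2

/-- `a` ties with `b`: there are as many pairs `(i, j)` with `a i > b j` as pairs with
`a i < b j`. -/
def Ties {n : ℕ} (a b : Fin n → ℕ) : Prop :=
  (Finset.univ.filter fun p : Fin n × Fin n => a p.1 > b p.2).card =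
    (Finset.univ.filter fun p : Fin n × Fin n => a p.1 < b p.2).card

/-- The law of a random `n`-sided die: the uniform probability measure on the set of `n`-sided
dice. -/
noncomputable def diceMeasure (n : ℕ) : Measure (Fin n → ℕ) :=
  uniformOn (dice n : Set (Fin n → ℕ))

/-! A die `B` ties with `A` exactly when `∑ j, gap A (B j) = 0`. For fixed `A`, a Fejér kernel
bounds the proportion of such `B` by `(2L+1)/n`, provided the characteristic function of this sum is
at most `1/n` at the frequencies `mπ/(8n)`, `L ≤ m < n`.

Restricting `B` to a prescribed sum costs a factor `n^2` (`pow_le_sq_mul_card_dice`) and twists the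
one-entry exponential sum by a linear character. Squaring that sum and grouping the pairs `x + y =
s` makes the twist constant on each group (`norm_sum_dice_prod_le`). Only the folded phases `θ (gap
A x + gap A (s - x))` remain, and it suffices that they are spread out for `n/2 < s ≤ n`
(`norm_sum_dice_exp_le_card_div`).

This holds for most `A`. Draw the entries of `A` independently and place `q` disjoint windows of
length `3T` below `s/2`. A small spread forces `cos ^ 2` of half the phase increment to average at
least `9/10` over each window. But the product of these cosines over all windows has mean at most
`(3/5)^q`, because its Fourier expansion factors over the entries of `A` and the reflection `a ↦ s -
a` makes each factor small (`sum_prod_cos_sq_le`). So the failure probability is at most `(2/3)^q`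
(`card_spread_lt_le`). With `q ≈ 27 log n` this is at most `n^{-9}`; a union over `s, m` and the
passage to dice cost `n^2` each, leaving `n^{-5}`. One can take `T` of order `n / log n` and `L` of
order `(log n)^2`. Part (i) then follows by Fubini. -/

/-! ### Lower bound for the number of dice -/

/-- A discrete intermediate value theorem. -/
theorem exists_sign_change {G : ℕ → ℤ} {n : ℕ} (hn : 0 < n) (h0 : G 0 ≤ 0) (h1 : 0 ≤ G n) :
    ∃ j < n, G j ≤ 0 ∧ 0 ≤ G (j + 1) := by
  by_contra! h
  have : ∀ j, j < n → G (j + 1) < 0 := by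
    intro j
    induction j with
    | zero => exact fun hj => h 0 hj h0
    | succ j ih => exact fun hj => h _ hj (ih (by omega)).le
  have := this (n - 1) (by omega)
  rw [Nat.sub_add_cancel hn] at this
  omega

/-- Reflecting every entry by `x ↦ n + 1 - x` negates the deviation of the sum from its target.
Undoing the reflection one entry at a time, the deviation changes sign at some entry `j`, and
altering that entry alone corrects the sum. -/
theorem exists_hybrid_mem_dice {n : ℕ} (hn : 0 < n) {a : Fin n → ℕ}
    (ha : ∀ i, 1 ≤ a i ∧ a i ≤ n) :
    ∃ j : Fin n, ∃ b ∈ dice n, (∀ i < j, b i = a i) ∧ ∀ i, j < i → b i = n + 1 - a i := by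
  set N : ℕ := n * (n + 1) / 2 with hN
  have hN2 : (2 * N : ℤ) = n * (n + 1) := by
    have : 2 * N = n * (n + 1) := Nat.mul_div_cancel' (Nat.even_mul_succ_self n).two_dvd
    exact_mod_cast this
  set y : ℕ → Fin n → ℤ := fun j i => if (i : ℕ) < j then (a i : ℤ) else n + 1 - a i with hy
  set G : ℕ → ℤ := fun j => ∑ i, y j i - N with hG
  have hend : G 0 + G n = 0 := by
    have : ∑ i, y 0 i + ∑ i, y n i = n * (n + 1) := by
      rw [← Finset.sum_add_distrib]
      simp [hy]
    simp only [hG]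
    linarith
  have hstep : ∀ j : Fin n, G (j + 1) - G j = 2 * a j - (n + 1) := by
    intro j
    have : ∑ i, (y (j + 1) i - y j i) = 2 * a j - (n + 1) := by
      rw [Finset.sum_eq_single j]
      · simp [hy]; ring
      · intro i _ hij
        have : (i : ℕ) ≠ j := fun h => hij (Fin.ext h)
        by_cases h : (i : ℕ) < j
        · simp [hy, h, Nat.lt_succ_of_lt h]
        · have h' : ¬ (i : ℕ) < j + 1 := by omega
          simp only [hy, h, h', if_false, sub_self]
      · simp
    rw [Finset.sum_sub_distrib] at this
    simp only [hG]
    linarith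
  -- The corrected entry is `n + 1 - a j - G j = a j - G (j + 1)`. As `G j` and `G (j + 1)` have
  -- opposite signs, it lies between `a j` and its reflection.
  have key : ∃ j : Fin n, 1 ≤ n + 1 - a j - G j ∧ n + 1 - a j - G j ≤ n := by
    rcases le_total (G 0) 0 with h | h
    · obtain ⟨j, hj, h1, h2⟩ := exists_sign_change hn h (by omega : 0 ≤ G n)
      refine ⟨⟨j, hj⟩, ?_⟩
      have := hstep ⟨j, hj⟩
      have := ha ⟨j, hj⟩
      simp only at *
      omega
    · obtain ⟨j, hj, h1, h2⟩ := exists_sign_change (G := fun j => - G j) hn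
        (by simpa using h) (by omega : 0 ≤ - G n)
      refine ⟨⟨j, hj⟩, ?_⟩
      have := hstep ⟨j, hj⟩
      have := ha ⟨j, hj⟩
      simp only at *
      omega
  obtain ⟨j, hv1, hv2⟩ := key
  set v : ℤ := n + 1 - a j - G j with hv
  set b : Fin n → ℕ := fun i => if i < j then a i else if i = j then v.toNat else n + 1 - a i
    with hb
  have hcast : ∀ i, (b i : ℤ) = if i = j then v else y j i := by
    intro i
    rcases lt_trichotomy i j with h | h | h
    · simp [hb, hy, h, h.ne, Fin.lt_def.mp h]
    · subst h; simp [hb]; omega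
    · have := ha i
      have h' : ¬ (i : ℕ) < j := by have := Fin.lt_def.mp h; omega
      simp only [hb, hy, not_lt.mpr h.le, h.ne', if_false, h']
      omega
  refine ⟨j, b, ?_, fun i hi => by simp [hb, hi], fun i hi => by
    simp [hb, not_lt.mpr hi.le, hi.ne']⟩
  simp only [dice, Finset.mem_filter, Fintype.mem_piFinset, Finset.mem_Icc]
  refine ⟨fun i => ?_, ?_⟩
  · have := ha i
    simp only [hb]
    split_ifs <;> omega
  · have h1 : ∑ i, ((b i : ℤ) - y j i) = v - y j j := by
      rw [Finset.sum_eq_single j]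
      · simp [hcast]
      · intro i _ hij; simp [hcast, hij]
      · simp
    have h2 : y j j = n + 1 - a j := by simp [hy]
    rw [Finset.sum_sub_distrib] at h1
    have : (∑ i, (b i : ℤ)) = N := by
      have : G j = ∑ i, y j i - N := rfl
      linarith
    exact_mod_cast this

/-- A sequence is recovered from its hybrid die, the index `j` and its entry at `j`, so the map to
these triples is injective. -/
theorem pow_le_sq_mul_card_dice {n : ℕ} (hn : 0 < n) : n ^ n ≤ n * (n * (dice n).card) := by
  have hex : ∀ a : Fin n → ℕ, ∃ p : Fin n × (Fin n → ℕ), (∀ i, 1 ≤ a i ∧ a i ≤ n) →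
      p.2 ∈ dice n ∧ (∀ i < p.1, p.2 i = a i) ∧ ∀ i, p.1 < i → p.2 i = n + 1 - a i := by
    intro a
    by_cases ha : ∀ i, 1 ≤ a i ∧ a i ≤ n
    · obtain ⟨j, b, h⟩ := exists_hybrid_mem_dice hn ha
      exact ⟨(j, b), fun _ => h⟩
    · exact ⟨(⟨0, hn⟩, a), fun h => absurd h ha⟩
  choose p hp using hex
  have hcard : (Fintype.piFinset fun _ : Fin n => Finset.Icc 1 n).card = n ^ n := by simp
  have htarget : ((Finset.univ : Finset (Fin n)) ×ˢ Finset.Icc 1 n ×ˢ dice n).card =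
      n * (n * (dice n).card) := by simp [Finset.card_product]
  rw [← hcard, ← htarget]
  refine Finset.card_le_card_of_injOn (fun a => ((p a).1, a (p a).1, (p a).2)) ?_ ?_
  · intro a ha
    simp only [Finset.mem_coe, Fintype.mem_piFinset, Finset.mem_Icc] at ha
    simp [ha, (hp a ha).1]
  · intro a ha a' ha' h
    simp only [Finset.mem_coe, Fintype.mem_piFinset, Finset.mem_Icc] at ha ha'
    simp only [Prod.mk.injEq] at h
    obtain ⟨h1, h2, h3⟩ := h
    obtain ⟨-, hlt, hgt⟩ := hp a ha
    obtain ⟨-, hlt', hgt'⟩ := hp a' ha'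
    rw [← h1, ← h3] at hlt' hgt'
    rw [← h1] at h2
    funext i
    rcases lt_trichotomy i (p a).1 with hi | hi | hi
    · rw [← hlt i hi, hlt' i hi]
    · rw [hi, h2]
    · have := hgt i hi
      have := hgt' i hi
      have := ha i
      have := ha' i
      omega

theorem dice_nonempty {n : ℕ} (hn : 0 < n) : (dice n).Nonempty := by
  rw [← Finset.card_pos]
  by_contra h
  have := pow_le_sq_mul_card_dice hn
  have := pow_pos hn n
  simp_all

/-! ### Exponential sums over dice and the Fejér kernel -/

/-- Orthogonality of the powers of a root of unity. -/
theorem geom_sum_root_of_unity {M : ℕ} {ζ : ℂ} (hζ : IsPrimitiveRoot ζ M) {σ N : ℕ}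
    (hσ : σ < M) (hN : N < M) :
    ∑ l ∈ Finset.range M, (ζ ^ σ * (ζ ^ N)⁻¹) ^ l = if σ = N then (M : ℂ) else 0 := by
  have hζ0 : ζ ≠ 0 := hζ.ne_zero (by omega)
  split_ifs with h
  · subst h
    simp [hζ0]
  · have hne : ζ ^ σ * (ζ ^ N)⁻¹ - 1 ≠ 0 := by
      rw [sub_ne_zero, Ne, mul_inv_eq_one₀ (pow_ne_zero _ hζ0)]
      exact fun he => h (hζ.pow_inj hσ hN he)
    have h1 : (ζ ^ σ * (ζ ^ N)⁻¹) ^ M = 1 := by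
      rw [mul_pow, inv_pow, ← pow_mul, ← pow_mul, mul_comm σ, mul_comm N, pow_mul, pow_mul,
        hζ.pow_eq_one]
      simp
    have := mul_geom_sum (ζ ^ σ * (ζ ^ N)⁻¹) M
    rw [h1, sub_self] at this
    exact (mul_eq_zero.mp this).resolve_left hne

/-- The sum of a multiplicative weight over the sequences with a prescribed sum is controlled by the
weights of the pairs of each given sum. -/
theorem norm_sum_dice_prod_le {n : ℕ} (w : ℕ → ℂ) :
    ‖∑ b ∈ dice n, ∏ i, w (b i)‖ ≤
      √(∑ s ∈ Finset.range (2 * n + 1),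
        ‖∑ p ∈ Finset.Icc 1 n ×ˢ Finset.Icc 1 n with p.1 + p.2 = s, w p.1 * w p.2‖) ^ n := by
  set U := ∑ s ∈ Finset.range (2 * n + 1),
    ‖∑ p ∈ Finset.Icc 1 n ×ˢ Finset.Icc 1 n with p.1 + p.2 = s, w p.1 * w p.2‖ with hU
  -- Every sum of entries is at most `n * n`, so congruence modulo `M` of such a sum to `N` is
  -- equality.
  set M := n * n + 1 with hM
  set N := n * (n + 1) / 2 with hN
  have hNM : N < M := by
    have : n * (n + 1) / 2 ≤ n * n := by
      apply Nat.div_le_of_le_mul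
      nlinarith [Nat.le_mul_self n]
    omega
  have hζ := Complex.isPrimitiveRoot_exp M (by omega)
  set ζ := Complex.exp (2 * ↑Real.pi * Complex.I / ↑M)
  have hζn : ‖ζ‖ = 1 := hζ.norm'_eq_one (by omega)
  -- After squaring, the character `x ↦ ζ ^ (l x)` contributes the common unit factor `ζ ^ (l s)` to
  -- all pairs of sum `s`; the bound is therefore uniform in `l`.
  have hsup : ∀ l : ℕ, ‖∑ x ∈ Finset.Icc 1 n, w x * (ζ ^ l) ^ x‖ ≤ √U := by
    intro l
    apply Real.le_sqrt_of_sq_le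
    rw [← norm_pow, sq, Finset.sum_mul_sum, ← Finset.sum_product',
      ← Finset.sum_fiberwise_of_maps_to (t := Finset.range (2 * n + 1)) (g := fun p => p.1 + p.2)]
    · refine (norm_sum_le _ _).trans (Finset.sum_le_sum fun s _ => ?_)
      have : ∑ p ∈ Finset.Icc 1 n ×ˢ Finset.Icc 1 n with p.1 + p.2 = s,
          w p.1 * (ζ ^ l) ^ p.1 * (w p.2 * (ζ ^ l) ^ p.2) =
          (∑ p ∈ Finset.Icc 1 n ×ˢ Finset.Icc 1 n with p.1 + p.2 = s, w p.1 * w p.2) *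
            (ζ ^ l) ^ s := by
        rw [Finset.sum_mul]
        refine Finset.sum_congr rfl fun p hp => ?_
        rw [← (Finset.mem_filter.mp hp).2, pow_add]
        ring
      rw [this, norm_mul, norm_pow, norm_pow, hζn]
      simp
    · intro p hp
      simp only [Finset.mem_product, Finset.mem_Icc] at hp
      simp only [Finset.mem_range]
      omega
  have hmain : (M : ℂ) * ∑ b ∈ dice n, ∏ i, w (b i) =
      ∑ l ∈ Finset.range M, ((ζ ^ N)⁻¹) ^ l * (∑ x ∈ Finset.Icc 1 n, w x * (ζ ^ l) ^ x) ^ n := by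
    have hexp : ∀ l : ℕ, (∑ x ∈ Finset.Icc 1 n, w x * (ζ ^ l) ^ x) ^ n =
        ∑ b ∈ Fintype.piFinset fun _ : Fin n => Finset.Icc 1 n,
          (∏ i, w (b i)) * (ζ ^ ∑ i, b i) ^ l := by
      intro l
      have := Finset.sum_prod_piFinset (ι := Fin n) (Finset.Icc 1 n)
        (fun _ x => w x * (ζ ^ l) ^ x)
      rw [Finset.prod_const, Finset.card_univ, Fintype.card_fin] at this
      rw [← this]
      refine Finset.sum_congr rfl fun b _ => ?_
      rw [Finset.prod_mul_distrib, Finset.prod_pow_eq_pow_sum, ← pow_mul, ← pow_mul, mul_comm l]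
    simp_rw [hexp, Finset.mul_sum]
    rw [Finset.sum_comm, dice, Finset.sum_filter]
    refine Finset.sum_congr rfl fun b hb => ?_
    have hbM : ∑ i, b i < M := by
      have : ∑ i, b i ≤ ∑ _i : Fin n, n := Finset.sum_le_sum fun i _ =>
        (Finset.mem_Icc.mp (Fintype.mem_piFinset.mp hb i)).2
      simp at this
      omega
    have := geom_sum_root_of_unity hζ hbM hNM
    have h2 : ∑ l ∈ Finset.range M, (ζ ^ N)⁻¹ ^ l * ((∏ i, w (b i)) * (ζ ^ ∑ i, b i) ^ l) =
        (∏ i, w (b i)) * ∑ l ∈ Finset.range M, (ζ ^ (∑ i, b i) * (ζ ^ N)⁻¹) ^ l := by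
      rw [Finset.mul_sum]
      refine Finset.sum_congr rfl fun l _ => ?_
      rw [mul_pow]; ring
    rw [h2, this]
    split_ifs <;> simp [mul_comm]
  have hle : (M : ℝ) * ‖∑ b ∈ dice n, ∏ i, w (b i)‖ ≤ M * √U ^ n := by
    calc (M : ℝ) * ‖∑ b ∈ dice n, ∏ i, w (b i)‖
        = ‖(M : ℂ) * ∑ b ∈ dice n, ∏ i, w (b i)‖ := by
          rw [norm_mul, Complex.norm_natCast]
      _ ≤ ∑ _l ∈ Finset.range M, √U ^ n := by
          rw [hmain]
          refine (norm_sum_le _ _).trans (Finset.sum_le_sum fun l _ => ?_)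
          rw [norm_mul, norm_pow, norm_inv, norm_pow, norm_pow, hζn]
          simp only [one_pow, inv_one, one_mul]
          exact pow_le_pow_left₀ (norm_nonneg _) (hsup l) n
      _ = M * √U ^ n := by simp
  exact le_of_mul_le_mul_left hle (by positivity)

/-- The squared modulus of a sum of unit complex numbers. -/
theorem sq_norm_sum_exp {ι : Type*} (X : Finset ι) (t : ι → ℝ) :
    ‖∑ x ∈ X, Complex.exp (t x * Complex.I)‖ ^ 2 = ∑ x ∈ X, ∑ y ∈ X, Real.cos (t x - t y) := by
  rw [Complex.sq_norm, Complex.normSq_apply, Complex.re_sum, Complex.im_sum]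
  simp_rw [Complex.exp_ofReal_mul_I_re, Complex.exp_ofReal_mul_I_im, Finset.sum_mul_sum,
    ← Finset.sum_add_distrib, Real.cos_sub]

/-- If the phases `t` are spread out, then the exponential sum over `X` has a saving. -/
theorem norm_sum_exp_le {ι : Type*} {X : Finset ι} {t : ι → ℝ} {n Y : ℝ} (hn : 0 < n)
    (hX : X.card ≤ n) (hY0 : 0 ≤ Y)
    (hY : Y ≤ ∑ x ∈ X, ∑ y ∈ X, Real.sin ((t x - t y) / 2) ^ 2) :
    ‖∑ x ∈ X, Complex.exp (t x * Complex.I)‖ ≤ X.card - Y / n := by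
  have h1 := sq_norm_sum_exp X t
  have h2 : ∑ x ∈ X, ∑ y ∈ X, Real.cos (t x - t y) =
      (X.card : ℝ) ^ 2 - 2 * ∑ x ∈ X, ∑ y ∈ X, Real.sin ((t x - t y) / 2) ^ 2 := by
    have : ∀ x y, Real.cos (t x - t y) = 1 - 2 * Real.sin ((t x - t y) / 2) ^ 2 := by
      intro x y
      rw [Real.sin_sq, ← mul_div_cancel₀ (t x - t y) (two_ne_zero' ℝ), Real.cos_two_mul]
      ring_nf
    simp_rw [this, Finset.sum_sub_distrib, ← Finset.mul_sum]
    simp; ring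
  rw [h2] at h1
  set q : ℝ := (X.card : ℝ)
  have hq : 0 ≤ q := Nat.cast_nonneg _
  have hYq : Y / n * q ≤ Y := by
    rw [div_mul_eq_mul_div, div_le_iff₀ hn]
    exact mul_le_mul_of_nonneg_left hX hY0
  have hYn : 0 ≤ Y / n := by positivity
  have hge : 0 ≤ q - Y / n := by
    by_contra! hlt
    have : 0 ≤ ‖∑ x ∈ X, Complex.exp (t x * Complex.I)‖ ^ 2 := by positivity
    rcases hq.eq_or_lt with h0 | h0
    · have : X = ∅ := by
        exact Finset.card_eq_zero.mp (Nat.cast_eq_zero.mp h0.symm)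
      subst this
      simp at hY
      have : Y = 0 := le_antisymm hY hY0
      rw [this, ← h0] at hlt
      simp at hlt
    · nlinarith [mul_lt_mul_of_pos_right (show q < Y / n by linarith) h0]
  apply abs_le_of_sq_le_sq' _ hge |>.2
  nlinarith [sq_nonneg (Y / n)]

/-- Counting zeros of a real statistic with a Fejér kernel. -/
theorem card_zero_le_fejer {β : Type*} (D : Finset β) (S : β → ℝ) (ω : ℝ) {n L : ℕ}
    (hn : 0 < n)
    (h : ∀ m : ℕ, L ≤ m → m < n →
      ‖∑ b ∈ D, Complex.exp ((m * ω * S b : ℝ) * Complex.I)‖ ≤ D.card / n) :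
    ((D.filter fun b => S b = 0).card : ℝ) ≤ D.card * ((2 * L + 1) / n) := by
  have hn' : (0 : ℝ) < n := by exact_mod_cast hn
  have hcos : ∀ m : ℕ, L ≤ m → m < n → ∑ b ∈ D, Real.cos (m * ω * S b) ≤ D.card / n := by
    intro m h1 h2
    refine le_trans ?_ (h m h1 h2)
    refine le_trans (le_of_eq ?_) (Complex.re_le_norm _)
    rw [Complex.re_sum]
    simp_rw [Complex.exp_ofReal_mul_I_re]
  have hcos' : ∀ m : ℕ, ∑ b ∈ D, Real.cos (m * ω * S b) ≤ D.card := by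
    intro m
    calc _ ≤ ∑ b ∈ D, (1 : ℝ) := Finset.sum_le_sum fun b _ => Real.cos_le_one _
      _ = _ := by simp
  have hdist : ∀ j k : ℕ, ∀ b, Real.cos (j * ω * S b - k * ω * S b) =
      Real.cos ((Nat.dist j k : ℕ) * ω * S b) := by
    intro j k b
    rcases le_total j k with hjk | hjk
    · rw [Nat.dist_eq_sub_of_le hjk, Nat.cast_sub hjk, ← Real.cos_neg]
      ring_nf
    · rw [Nat.dist_eq_sub_of_le_right hjk, Nat.cast_sub hjk]
      ring_nf
  have hrow : ∀ j ∈ Finset.range n, ∑ k ∈ Finset.range n,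
      ∑ b ∈ D, Real.cos ((Nat.dist j k : ℕ) * ω * S b) ≤ D.card * (2 * L + 1) := by
    intro j hj
    have hj := Finset.mem_range.mp hj
    calc _ ≤ ∑ k ∈ Finset.range n, ((if Nat.dist j k < L then (D.card : ℝ) else 0) + D.card / n) := by
          refine Finset.sum_le_sum fun k hk => ?_
          have hk := Finset.mem_range.mp hk
          split_ifs with hd
          · have := hcos' (Nat.dist j k)
            have : (0 : ℝ) ≤ D.card / n := by positivity
            linarith
          · rw [zero_add]
            exact hcos _ (not_lt.mp hd) (by unfold Nat.dist; omega)
      _ = ((Finset.range n).filter fun k => Nat.dist j k < L).card * (D.card : ℝ) + D.card := by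
          rw [Finset.sum_add_distrib, ← Finset.sum_filter, Finset.sum_const, Finset.sum_const]
          simp only [nsmul_eq_mul, Finset.card_range]
          field_simp
      _ ≤ (2 * L : ℕ) * (D.card : ℝ) + D.card := by
          gcongr
          calc _ ≤ (Finset.Ico (j + 1 - L) (j + L)).card := by
                apply Finset.card_le_card
                intro k hk
                have hd := (Finset.mem_filter.mp hk).2
                rw [Finset.mem_Ico]
                unfold Nat.dist at hd
                omega
            _ ≤ 2 * L := by simp; omega
      _ = _ := by push_cast; ring
  -- The double sum is a squared modulus, hence nonnegative, and equals `n ^ 2` at a zero of `S`.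
  have hnonneg : ∀ b, ((n : ℝ) ^ 2 * if S b = 0 then 1 else 0) ≤
      ∑ j ∈ Finset.range n, ∑ k ∈ Finset.range n, Real.cos (j * ω * S b - k * ω * S b) := by
    intro b
    split_ifs with hb
    · simp [hb, sq]
    · have := sq_norm_sum_exp (Finset.range n) (fun j => (j * ω * S b : ℝ))
      rw [← this]
      simp only [mul_zero]
      positivity
  have htot : (n : ℝ) ^ 2 * ((D.filter fun b => S b = 0).card : ℝ) ≤
      n * (D.card * (2 * L + 1)) := by
    calc (n : ℝ) ^ 2 * ((D.filter fun b => S b = 0).card : ℝ)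
        = ∑ b ∈ D, ((n : ℝ) ^ 2 * if S b = 0 then 1 else 0) := by
          rw [← Finset.mul_sum, Finset.sum_boole]
      _ ≤ ∑ b ∈ D, ∑ j ∈ Finset.range n, ∑ k ∈ Finset.range n,
            Real.cos (j * ω * S b - k * ω * S b) := Finset.sum_le_sum fun b _ => hnonneg b
      _ = ∑ j ∈ Finset.range n, ∑ k ∈ Finset.range n,
            ∑ b ∈ D, Real.cos ((Nat.dist j k : ℕ) * ω * S b) := by
          rw [Finset.sum_comm]
          refine Finset.sum_congr rfl fun j _ => ?_
          rw [Finset.sum_comm]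
          simp_rw [hdist]
      _ ≤ ∑ j ∈ Finset.range n, (D.card * (2 * L + 1) : ℝ) := Finset.sum_le_sum hrow
      _ = _ := by simp
  rw [mul_div_assoc', le_div_iff₀ hn']
  refine le_of_mul_le_mul_left ?_ hn'
  linarith

/-! ### Ties against a fixed die and the spread of its phases -/

/-- The number of entries of `a` below `x` minus the number of those above `x`. -/
def gap {n : ℕ} (a : Fin n → ℕ) (x : ℕ) : ℤ := ∑ i, Int.sign ((x : ℤ) - a i)

theorem ties_iff_sum_gap {n : ℕ} (a b : Fin n → ℕ) : Ties a b ↔ ∑ j, gap a (b j) = 0 := by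
  have hsign : ∀ p : Fin n × Fin n, Int.sign ((b p.2 : ℤ) - a p.1) =
      (if a p.1 < b p.2 then 1 else 0) - if a p.1 > b p.2 then 1 else 0 := by
    intro p
    rcases lt_trichotomy (a p.1) (b p.2) with h | h | h
    · rw [Int.sign_eq_one_of_pos (by omega)]; simp [h, h.not_gt]
    · simp [h]
    · rw [Int.sign_eq_neg_one_of_neg (by omega)]; simp [h, h.not_gt]
  have hsum : ∑ j, gap a (b j) =
      (Finset.univ.filter fun p : Fin n × Fin n => a p.1 < b p.2).card -
        ((Finset.univ.filter fun p : Fin n × Fin n => a p.1 > b p.2).card : ℤ) := by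
    simp only [gap]
    rw [Finset.sum_comm, ← Fintype.sum_prod_type'
      (f := fun i j => Int.sign ((b j : ℤ) - a i))]
    simp_rw [hsign, Finset.sum_sub_distrib, Finset.sum_boole]
  rw [hsum, Ties]
  omega

/-- How spread out the phases `θ (gap a x + gap a (s - x))` are. -/
noncomputable def spread {n : ℕ} (a : Fin n → ℕ) (s : ℕ) (θ : ℝ) : ℝ :=
  ∑ x ∈ Finset.Icc 1 (s - 1), ∑ y ∈ Finset.Icc 1 (s - 1),
    Real.sin ((θ * (gap a x + gap a (s - x) : ℤ) - θ * (gap a y + gap a (s - y) : ℤ)) / 2) ^ 2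

theorem pairs_eq_image {n s : ℕ} (hs : s ≤ n) :
    (Finset.Icc 1 n ×ˢ Finset.Icc 1 n).filter (fun p => p.1 + p.2 = s) =
      (Finset.Icc 1 (s - 1)).image fun x => (x, s - x) := by
  ext ⟨x, y⟩
  simp only [Finset.mem_filter, Finset.mem_product, Finset.mem_Icc, Finset.mem_image,
    Prod.mk.injEq]
  constructor
  · intro h
    exact ⟨x, by omega, rfl, by omega⟩
  · rintro ⟨z, hz, rfl, rfl⟩
    omega

theorem norm_pair_sum_le {n s : ℕ} (a : Fin n → ℕ) {θ Y : ℝ} (hn : 0 < n) (hs : s ≤ n)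
    (hY0 : 0 ≤ Y) (hY : Y ≤ spread a s θ) :
    ‖∑ p ∈ Finset.Icc 1 n ×ˢ Finset.Icc 1 n with p.1 + p.2 = s,
        Complex.exp ((θ * gap a p.1 : ℝ) * Complex.I) *
          Complex.exp ((θ * gap a p.2 : ℝ) * Complex.I)‖ ≤
      ((Finset.Icc 1 n ×ˢ Finset.Icc 1 n).filter fun p => p.1 + p.2 = s).card - Y / n := by
  have hinj : Set.InjOn (fun x : ℕ => (x, s - x)) (Finset.Icc 1 (s - 1)) :=
    fun x _ y _ h => (Prod.mk.injEq _ _ _ _ ▸ h).1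
  rw [pairs_eq_image hs, Finset.sum_image hinj, Finset.card_image_of_injOn hinj]
  have := norm_sum_exp_le (X := Finset.Icc 1 (s - 1))
    (t := fun x => θ * (gap a x + gap a (s - x) : ℤ)) (n := n) (Y := Y)
    (by exact_mod_cast hn) (by rw [Nat.card_Icc]; exact_mod_cast (by omega : s - 1 + 1 - 1 ≤ n)) hY0 hY
  convert this using 4 with x _
  rw [← Complex.exp_add]
  push_cast
  ring_nf

/-- At least `n / 2` values of `s` each save `Y / n` over the trivial bound; the other pair sums are
bounded trivially, and there are `n ^ 2` pairs in all. -/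
theorem norm_sum_dice_exp_le {n : ℕ} (a : Fin n → ℕ) {θ Y : ℝ} (hn : 0 < n)
    (hY0 : 0 ≤ Y) (hY : ∀ s, n / 2 < s → s ≤ n → Y ≤ spread a s θ) :
    ‖∑ b ∈ dice n, Complex.exp ((θ * (∑ j, gap a (b j) : ℤ) : ℝ) * Complex.I)‖ ≤
      √((n : ℝ) ^ 2 - Y / 2) ^ n := by
  have hn' : (0 : ℝ) < n := by exact_mod_cast hn
  have h := norm_sum_dice_prod_le (n := n) fun x => Complex.exp ((θ * gap a x : ℝ) * Complex.I)
  have hprod : ∀ b : Fin n → ℕ, ∏ i, Complex.exp ((θ * gap a (b i) : ℝ) * Complex.I) =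
      Complex.exp ((θ * (∑ j, gap a (b j) : ℤ) : ℝ) * Complex.I) := by
    intro b
    rw [← Complex.exp_sum]
    push_cast
    rw [Finset.mul_sum, Finset.sum_mul]
  simp_rw [hprod] at h
  refine h.trans ?_
  gcongr
  set c : ℕ → ℕ := fun s =>
    ((Finset.Icc 1 n ×ˢ Finset.Icc 1 n).filter fun p => p.1 + p.2 = s).card with hc
  have hcsum : ∑ s ∈ Finset.range (2 * n + 1), (c s : ℝ) = (n : ℝ) ^ 2 := by
    have := Finset.card_eq_sum_card_fiberwise (f := fun p : ℕ × ℕ => p.1 + p.2)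
      (s := Finset.Icc 1 n ×ˢ Finset.Icc 1 n) (t := Finset.range (2 * n + 1)) (by
        intro p hp
        simp only [Finset.coe_product, Set.mem_prod, Finset.mem_coe, Finset.mem_Icc] at hp
        simp only [Finset.coe_range, Set.mem_Iio]
        omega)
    simp only [Finset.card_product, Nat.card_Icc, Nat.add_sub_cancel] at this
    rw [sq]
    exact_mod_cast this.symm
  calc _ ≤ ∑ s ∈ Finset.range (2 * n + 1),
        ((c s : ℝ) - if s ∈ Finset.Ioc (n / 2) n then Y / n else 0) := by
        refine Finset.sum_le_sum fun s _ => ?_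
        split_ifs with hs
        · rw [Finset.mem_Ioc] at hs
          exact norm_pair_sum_le a hn hs.2 hY0 (hY s hs.1 hs.2)
        · rw [sub_zero]
          refine (norm_sum_le _ _).trans (le_of_eq ?_)
          simp_rw [norm_mul, Complex.norm_exp_ofReal_mul_I]
          simp [hc]
    _ = (n : ℝ) ^ 2 - ((n - n / 2 : ℕ) : ℝ) * (Y / n) := by
        rw [Finset.sum_sub_distrib, hcsum, ← Finset.sum_filter, Finset.sum_const, nsmul_eq_mul]
        congr 3
        have : (Finset.range (2 * n + 1)).filter (fun s => s ∈ Finset.Ioc (n / 2) n) =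
            Finset.Ioc (n / 2) n := by
          ext s
          simp only [Finset.mem_filter, Finset.mem_range, Finset.mem_Ioc]
          omega
        rw [this, Nat.card_Ioc]
    _ ≤ (n : ℝ) ^ 2 - Y / 2 := by
        have h1 : (n : ℝ) / 2 ≤ ((n - n / 2 : ℕ) : ℝ) := by
          have : n ≤ 2 * (n - n / 2) := by omega
          have : (n : ℝ) ≤ 2 * ((n - n / 2 : ℕ) : ℝ) := by exact_mod_cast this
          linarith
        have h2 : (n : ℝ) / 2 * (Y / n) = Y / 2 := by field_simp
        have := mul_le_mul_of_nonneg_right h1 (by positivity : 0 ≤ Y / n)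
        linarith

/-- If all the phases are spread out, the characteristic function of the number of wins minus losses
against `a` is small. -/
theorem norm_sum_dice_exp_le_card_div {n : ℕ} (a : Fin n → ℕ) {θ : ℝ} (hn : 0 < n)
    (hY : ∀ s, n / 2 < s → s ≤ n → 12 * n * Real.log n ≤ spread a s θ) :
    ‖∑ b ∈ dice n, Complex.exp ((θ * (∑ j, gap a (b j) : ℤ) : ℝ) * Complex.I)‖ ≤
      (dice n).card / n := by
  have hn' : (0 : ℝ) < n := by exact_mod_cast hn
  have hlog : 0 ≤ Real.log n := Real.log_natCast_nonneg n
  refine (norm_sum_dice_exp_le a hn (by positivity) hY).trans ?_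
  -- The `n`-th power of this bound is `n ^ n / n ^ 3`: two factors of `n` pay for restricting to
  -- dice and the third is the gain.
  have h1 : √((n : ℝ) ^ 2 - 12 * n * Real.log n / 2) ≤ n * Real.exp (-(3 * Real.log n / n)) := by
    apply Real.sqrt_le_iff.mpr ⟨by positivity, ?_⟩
    have h2 := Real.add_one_le_exp (-(6 * Real.log n / n))
    have h3 : (n * Real.exp (-(3 * Real.log n / n))) ^ 2 =
        n ^ 2 * Real.exp (-(6 * Real.log n / n)) := by
      rw [mul_pow, ← Real.exp_nat_mul]
      congr 2
      push_cast; ring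
    rw [h3]
    have h4 := mul_le_mul_of_nonneg_left h2 (by positivity : (0 : ℝ) ≤ n ^ 2)
    refine le_trans (le_of_eq ?_) h4
    field_simp
    ring
  have h5 : (n * Real.exp (-(3 * Real.log n / n))) ^ n = (n : ℝ) ^ n / n ^ 3 := by
    have : (n : ℝ) * -(3 * Real.log n / n) = -(3 * Real.log n) := by field_simp
    rw [mul_pow, ← Real.exp_nat_mul, this, Real.exp_neg, mul_comm 3, Real.exp_mul,
      Real.exp_log hn', div_eq_mul_inv]
    norm_cast
  have h6 : (n : ℝ) ^ n ≤ n * (n * (dice n).card) := by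
    exact_mod_cast pow_le_sq_mul_card_dice hn
  calc _ ≤ (n * Real.exp (-(3 * Real.log n / n))) ^ n := by gcongr
    _ = (n : ℝ) ^ n / n ^ 3 := h5
    _ ≤ n * (n * (dice n).card) / n ^ 3 := by gcongr
    _ = (dice n).card / n := by field_simp

theorem card_ties_le {n L : ℕ} (a : Fin n → ℕ) {ω : ℝ} (hn : 0 < n)
    (h : ∀ s, n / 2 < s → s ≤ n → ∀ m : ℕ, L ≤ m → m < n →
      12 * n * Real.log n ≤ spread a s (m * ω)) :
    (((dice n : Set (Fin n → ℕ)) ∩ {b | Ties a b}).ncard : ℝ) ≤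
      (dice n).card * ((2 * L + 1) / n) := by
  classical
  have := card_zero_le_fejer (dice n) (fun b => ((∑ j, gap a (b j) : ℤ) : ℝ)) ω (L := L) hn
    fun m h1 h2 => norm_sum_dice_exp_le_card_div a hn fun s hs1 hs2 => h s hs1 hs2 m h1 h2
  refine le_trans (le_of_eq ?_) this
  rw [← Set.ncard_coe_finset]
  congr 2
  ext b
  simp only [Set.mem_inter_iff, Finset.mem_coe, Set.mem_ofPred_eq, Finset.coe_filter,
    ties_iff_sum_gap, Int.cast_eq_zero]

/-! ### Increments of the folded gap over disjoint windows -/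

/-- The contribution of an entry `a` to the increment between `y` and `x` of the folded gap
`z ↦ gap z + gap (s - z)`. -/
def foldStep (s x y a : ℕ) : ℤ :=
  Int.sign ((x : ℤ) - a) + Int.sign (((s - x : ℕ) : ℤ) - a) -
    (Int.sign ((y : ℤ) - a) + Int.sign (((s - y : ℕ) : ℤ) - a))

theorem sum_foldStep {n : ℕ} (A : Fin n → ℕ) (s x y : ℕ) :
    ∑ i, foldStep s x y (A i) =
      gap A x + gap A (s - x) - (gap A y + gap A (s - y)) := by
  simp only [foldStep, gap, Finset.sum_sub_distrib, Finset.sum_add_distrib]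

/-- Reflection exchanges the two signs attached to a point and negates them. This oddness turns the
phases of `a` and `s - a` into a conjugate pair. -/
theorem foldStep_reflect {s x y a : ℕ} (hx : x ≤ s) (hy : y ≤ s) (ha : a ≤ s) :
    foldStep s x y (s - a) = -foldStep s x y a := by
  have key : ∀ z ≤ s, Int.sign ((z : ℤ) - (s - a : ℕ)) = -Int.sign (((s - z : ℕ) : ℤ) - a) ∧
      Int.sign (((s - z : ℕ) : ℤ) - (s - a : ℕ)) = -Int.sign ((z : ℤ) - a) := by
    intro z hz
    rw [← Int.sign_neg, ← Int.sign_neg]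
    constructor <;> congr 1 <;> omega
  simp only [foldStep, (key x hx).1, (key x hx).2, (key y hy).1, (key y hy).2]
  ring

theorem foldStep_of_between {s x y a : ℕ} (hxa : x < a) (hay : a < y) (hy : 2 * y < s) :
    foldStep s x y a = -2 := by
  rw [foldStep, Int.sign_eq_neg_one_of_neg (by omega), Int.sign_eq_one_of_pos (by omega),
    Int.sign_eq_one_of_pos (by omega), Int.sign_eq_one_of_pos (by omega)]
  norm_num

theorem foldStep_of_lt {s x y a : ℕ} (hax : a < x) (hay : a < y) (hx : 2 * x < s)
    (hy : 2 * y < s) : foldStep s x y a = 0 := by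
  rw [foldStep, Int.sign_eq_one_of_pos (by omega), Int.sign_eq_one_of_pos (by omega),
    Int.sign_eq_one_of_pos (by omega), Int.sign_eq_one_of_pos (by omega)]
  norm_num

theorem foldStep_of_gt {s x y a : ℕ} (hxa : x < a) (hya : y < a) (hx : 2 * x < s)
    (hy : 2 * y < s) (ha : 2 * a < s) : foldStep s x y a = 0 := by
  rw [foldStep, Int.sign_eq_neg_one_of_neg (by omega), Int.sign_eq_one_of_pos (by omega),
    Int.sign_eq_neg_one_of_neg (by omega), Int.sign_eq_one_of_pos (by omega)]
  norm_num

/-- An exponential sum whose phase changes sign under the reflection `a ↦ s - a` of a set `M` and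
has absolute value `2 θ` there. -/
theorem norm_sum_exp_reflect_le {I M : Finset ℕ} {s : ℕ} {θ : ℝ} {f : ℕ → ℤ} (hM : M ⊆ I)
    (hM' : ∀ a ∈ M, s - a ∈ I) (hs : ∀ a ∈ M, 2 * a < s) (hf : ∀ a ∈ M, f (s - a) = -f a)
    (hf2 : ∀ a ∈ M, f a = 2 ∨ f a = -2) (hθ : 0 ≤ Real.cos (2 * θ)) :
    ‖∑ a ∈ I, Complex.exp ((θ * f a : ℝ) * Complex.I)‖ ≤
      I.card - 2 * M.card * (1 - Real.cos (2 * θ)) := by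
  set e : ℕ → ℂ := fun a => Complex.exp ((θ * f a : ℝ) * Complex.I)
  have he : ∀ a, ‖e a‖ = 1 := fun a => Complex.norm_exp_ofReal_mul_I _
  set M' := M.image (s - ·)
  have hinj : Set.InjOn (s - ·) (M : Set ℕ) := by
    intro a ha b hb h
    have := hs a ha
    have := hs b hb
    simp only at h
    omega
  have hcard : M'.card = M.card := Finset.card_image_of_injOn hinj
  have hdisj : Disjoint M M' := by
    rw [Finset.disjoint_left]
    intro a ha ha'
    obtain ⟨b, hb, rfl⟩ := Finset.mem_image.mp ha'
    have := hs b hb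
    have := hs _ ha
    omega
  have hsub : M ∪ M' ⊆ I := by
    refine Finset.union_subset hM fun a ha => ?_
    obtain ⟨b, hb, rfl⟩ := Finset.mem_image.mp ha
    exact hM' b hb
  have hpair : ∀ a ∈ M, ‖e a + e (s - a)‖ = 2 * Real.cos (2 * θ) := by
    intro a ha
    have h1 : e a + e (s - a) = ((2 * Real.cos (2 * θ) : ℝ) : ℂ) := by
      simp only [e, hf a ha]
      rcases hf2 a ha with h | h <;> rw [h] <;> push_cast <;> rw [Complex.cos] <;> ring_nf
    rw [h1, Complex.norm_of_nonneg (by positivity)]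
  have hcardI : ((I \ (M ∪ M')).card : ℝ) = I.card - 2 * M.card := by
    rw [Finset.cast_card_sdiff hsub, Finset.card_union_of_disjoint hdisj, hcard]
    push_cast; ring
  rw [← Finset.sum_sdiff hsub, Finset.sum_union hdisj, Finset.sum_image hinj,
    ← Finset.sum_add_distrib]
  calc _ ≤ ∑ a ∈ I \ (M ∪ M'), ‖e a‖ + ∑ a ∈ M, ‖e a + e (s - a)‖ :=
        (norm_add_le _ _).trans (add_le_add (norm_sum_le _ _) (norm_sum_le _ _))
    _ = (I.card - 2 * M.card) + M.card * (2 * Real.cos (2 * θ)) := by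
        rw [Finset.sum_congr rfl hpair]
        simp [he, hcardI]
    _ = _ := by ring

/-- The middle thirds of the windows of length `3 T`. -/
def midBlock (T w : ℕ) : Finset ℕ := Finset.Ioc (3 * w * T + T) (3 * w * T + 2 * T)

/-- The pairs consisting of a point of the first and a point of the last third of a window of length
`3 T`. -/
def outerPairs (T w : ℕ) : Finset (ℕ × ℕ) :=
  Finset.Ioc (3 * w * T) (3 * w * T + T) ×ˢ Finset.Ioc (3 * w * T + 2 * T) (3 * w * T + 3 * T)

theorem window_le {T w q : ℕ} (h : w < q) : 3 * w * T + 3 * T ≤ 3 * q * T := by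
  have : (w + 1) * T ≤ q * T := Nat.mul_le_mul_right T h
  linarith

/-- On a middle third only the increment of its own window is nonzero, and it does not depend on the
chosen outer points. A combination with coefficients `τ` is thus `-2 * τ w` there. -/
theorem foldStep_midBlock {T q s : ℕ} (hs : 6 * q * T < s) {v w : ℕ} (hv : v < q) (hw : w < q)
    {z : ℕ × ℕ} (hz : z ∈ outerPairs T v) {a : ℕ} (ha : a ∈ midBlock T w) :
    foldStep s z.1 z.2 a = if v = w then -2 else 0 := by
  simp only [outerPairs, midBlock, Finset.mem_product, Finset.mem_Ioc] at hz ha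
  have hv' := window_le (T := T) hv
  have hw' := window_le (T := T) hw
  have hqs : 2 * (3 * q * T) < s := by linarith
  split_ifs with h
  · subst h
    exact foldStep_of_between (by omega) (by omega) (by omega)
  · rcases Nat.lt_or_gt_of_ne h with h | h
    · have := window_le (T := T) h
      exact foldStep_of_gt (by omega) (by omega) (by omega) (by omega) (by omega)
    · have := window_le (T := T) h
      exact foldStep_of_lt (by omega) (by omega) (by omega) (by omega)

/-- The middle thirds of the windows with `τ w ≠ 0`, paired with their reflections, supply all the
saving; the remaining terms are bounded by `1`. -/
theorem norm_sum_exp_windows_le {n q T s : ℕ} {θ : ℝ} (hs : 6 * q * T < s) (hsn : s ≤ n)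
    (hθ : 0 ≤ Real.cos (2 * θ)) {z : Fin q → ℕ × ℕ} (hz : ∀ w : Fin q, z w ∈ outerPairs T w)
    {τ : Fin q → ℤ} (hτ : ∀ w, τ w ∈ Finset.Icc (-1 : ℤ) 1) :
    ‖∑ a ∈ Finset.Icc 1 n,
        Complex.exp ((θ * (∑ w, τ w * foldStep s (z w).1 (z w).2 a : ℤ) : ℝ) * Complex.I)‖ ≤
      n - 2 * ((Finset.univ.filter fun w => τ w ≠ 0).card * T) * (1 - Real.cos (2 * θ)) := by
  have hqs : 2 * (3 * q * T) < s := by linarith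
  set K := Finset.univ.filter fun w => τ w ≠ 0
  set M := K.biUnion fun w => midBlock T w
  have hMmem : ∀ a ∈ M, 0 < a ∧ 2 * a < s := by
    intro a ha
    obtain ⟨w, -, hw⟩ := Finset.mem_biUnion.mp ha
    have := window_le (T := T) w.2
    simp only [midBlock, Finset.mem_Ioc] at hw
    omega
  have hcard : M.card = K.card * T := by
    rw [Finset.card_biUnion]
    · rw [Finset.sum_const_nat]
      intro w _
      rw [midBlock, Nat.card_Ioc]
      omega
    · intro v _ w _ hvw
      rw [Function.onFun, Finset.disjoint_left]
      intro a ha hb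
      simp only [midBlock, Finset.mem_Ioc] at ha hb
      rcases Nat.lt_or_gt_of_ne (fun h => hvw (Fin.ext h)) with h | h
      · have := window_le (T := T) h
        omega
      · have := window_le (T := T) h
        omega
  have hzs : ∀ w, (z w).1 ≤ s ∧ (z w).2 ≤ s := by
    intro w
    have h := hz w
    have := window_le (T := T) w.2
    simp only [outerPairs, Finset.mem_product, Finset.mem_Ioc] at h
    omega
  have := norm_sum_exp_reflect_le (I := Finset.Icc 1 n) (M := M) (s := s) (θ := θ)
    (f := fun a => ∑ w, τ w * foldStep s (z w).1 (z w).2 a) ?_ ?_ (fun a ha => (hMmem a ha).2)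
    ?_ ?_ hθ
  · rw [hcard] at this
    refine this.trans (le_of_eq ?_)
    simp
  · intro a ha
    have := hMmem a ha
    rw [Finset.mem_Icc]
    omega
  · intro a ha
    have := hMmem a ha
    rw [Finset.mem_Icc]
    omega
  · intro a ha
    have := hMmem a ha
    rw [← Finset.sum_neg_distrib]
    refine Finset.sum_congr rfl fun w _ => ?_
    rw [foldStep_reflect (hzs w).1 (hzs w).2 (by omega)]
    ring
  · intro a ha
    obtain ⟨w, hwK, hw⟩ := Finset.mem_biUnion.mp ha
    have hsum : ∑ v, τ v * foldStep s (z v).1 (z v).2 a = -2 * τ w := by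
      rw [Finset.sum_eq_single w]
      · rw [foldStep_midBlock hs w.2 w.2 (hz w) hw, if_pos rfl]
        ring
      · intro v _ hvw
        rw [foldStep_midBlock hs v.2 w.2 (hz v) hw, if_neg fun h => hvw (Fin.ext h), mul_zero]
      · simp
    have h1 := hτ w
    have h2 : τ w ≠ 0 := (Finset.mem_filter.mp hwK).2
    rw [Finset.mem_Icc] at h1
    rw [hsum]
    omega

/-! ### Most sequences have large spread -/

/-- The Fourier weights of `cos ^ 2`. -/
noncomputable def cosSqWeight (t : ℤ) : ℝ := if t = 0 then 1 / 2 else 1 / 4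

theorem cos_sq_eq_sum (y : ℝ) :
    ((Real.cos (y / 2) ^ 2 : ℝ) : ℂ) =
      ∑ t ∈ Finset.Icc (-1 : ℤ) 1, (cosSqWeight t : ℂ) * Complex.exp ((t * y : ℝ) * Complex.I) := by
  have h : Finset.Icc (-1 : ℤ) 1 = {-1, 0, 1} := by decide
  rw [Real.cos_sq, h]
  push_cast
  rw [mul_div_cancel₀ _ (two_ne_zero' ℂ), Complex.cos]
  simp [cosSqWeight]
  ring

/-- Expanding each `cos ^ 2` into frequencies `τ w ∈ {-1, 0, 1}` makes every term an `n`-th power of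
a one-entry sum. By `hT`, each nonzero `τ w` saves `2` in that sum, hence a factor `exp (-2)` in the
power, so a window contributes at most `1/2 + exp (-2) / 2`. -/
theorem sum_prod_cos_sq_le {n q T s : ℕ} {θ : ℝ} (hs : 6 * q * T < s) (hsn : s ≤ n)
    (hθ : 0 ≤ Real.cos (2 * θ)) (hT : 1 ≤ T * (1 - Real.cos (2 * θ)))
    {z : Fin q → ℕ × ℕ} (hz : ∀ w : Fin q, z w ∈ outerPairs T w) :
    ∑ A ∈ Fintype.piFinset fun _ : Fin n => Finset.Icc 1 n,
        ∏ w, Real.cos (θ * (∑ i, foldStep s (z w).1 (z w).2 (A i) : ℤ) / 2) ^ 2 ≤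
      (n : ℝ) ^ n * (3 / 5) ^ q := by
  have hn : 0 < n := by omega
  have hn' : (0 : ℝ) < n := by exact_mod_cast hn
  set E : (Fin q → ℤ) → ℕ → ℂ := fun τ a =>
    Complex.exp ((θ * (∑ w, τ w * foldStep s (z w).1 (z w).2 a : ℤ) : ℝ) * Complex.I) with hE
  have hcomplex : ((∑ A ∈ Fintype.piFinset fun _ : Fin n => Finset.Icc 1 n,
        ∏ w, Real.cos (θ * (∑ i, foldStep s (z w).1 (z w).2 (A i) : ℤ) / 2) ^ 2 : ℝ) : ℂ) =
      ∑ τ ∈ Fintype.piFinset fun _ : Fin q => Finset.Icc (-1 : ℤ) 1,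
        (∏ w, (cosSqWeight (τ w) : ℂ)) * (∑ a ∈ Finset.Icc 1 n, E τ a) ^ n := by
    rw [Complex.ofReal_sum]
    simp_rw [Complex.ofReal_prod, cos_sq_eq_sum, Finset.prod_univ_sum]
    rw [Finset.sum_comm]
    refine Finset.sum_congr rfl fun τ _ => ?_
    have := Finset.sum_prod_piFinset (ι := Fin n) (Finset.Icc 1 n) (fun _ a => E τ a)
    rw [Finset.prod_const, Finset.card_univ, Fintype.card_fin] at this
    rw [← this, Finset.mul_sum]
    refine Finset.sum_congr rfl fun A _ => ?_
    rw [Finset.prod_mul_distrib]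
    congr 1
    simp only [hE]
    rw [← Complex.exp_sum, ← Complex.exp_sum]
    congr 1
    push_cast
    rw [← Finset.sum_mul, ← Finset.sum_mul, ← Finset.mul_sum, Finset.sum_comm, Finset.mul_sum]
    congr 1
    refine Finset.sum_congr rfl fun w _ => ?_
    rw [← Finset.mul_sum]
    ring
  have hterm : ∀ τ ∈ Fintype.piFinset fun _ : Fin q => Finset.Icc (-1 : ℤ) 1,
      ‖(∏ w, (cosSqWeight (τ w) : ℂ)) * (∑ a ∈ Finset.Icc 1 n, E τ a) ^ n‖ ≤
        (n : ℝ) ^ n * ∏ w, (cosSqWeight (τ w) * if τ w = 0 then 1 else Real.exp (-2)) := by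
    intro τ hτ
    set k := (Finset.univ.filter fun w => τ w ≠ 0).card with hk
    have h1 : ‖∑ a ∈ Finset.Icc 1 n, E τ a‖ ≤ n * Real.exp (-(2 * k / n)) := by
      refine (norm_sum_exp_windows_le hs hsn hθ hz fun w => Fintype.mem_piFinset.mp hτ w).trans ?_
      have h2 : (k : ℝ) * 1 ≤ k * (T * (1 - Real.cos (2 * θ))) := by gcongr
      have h3 := mul_le_mul_of_nonneg_left (Real.add_one_le_exp (-(2 * k / n) : ℝ)) hn'.le
      have h4 : (n : ℝ) * (-(2 * k / n) + 1) = n - 2 * k := by field_simp; ring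
      rw [h4] at h3
      refine le_trans ?_ h3
      linarith
    have h5 : ∏ w, (if τ w = 0 then 1 else Real.exp (-2)) = Real.exp (-2) ^ k := by
      rw [Finset.prod_ite]
      simp [hk]
    have hc : ∀ t, 0 ≤ cosSqWeight t := fun t => by unfold cosSqWeight; split_ifs <;> norm_num
    rw [norm_mul, norm_prod, norm_pow, Finset.prod_mul_distrib, h5]
    simp_rw [Complex.norm_of_nonneg (hc _)]
    have h6 : (n * Real.exp (-(2 * k / n))) ^ n = (n : ℝ) ^ n * Real.exp (-2) ^ k := by
      rw [mul_pow, ← Real.exp_nat_mul, ← Real.exp_nat_mul]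
      congr 2
      field_simp
    calc _ ≤ (∏ w, cosSqWeight (τ w)) * (n * Real.exp (-(2 * k / n))) ^ n := by
          gcongr
          exact Finset.prod_nonneg fun w _ => hc _
      _ = _ := by rw [h6]; ring
  have hexp : Real.exp (-2) ≤ 1 / 5 := by
    have h1 := Real.exp_one_gt_d9
    have h2 : Real.exp 2 = Real.exp 1 * Real.exp 1 := by rw [← Real.exp_add]; norm_num
    rw [Real.exp_neg, inv_le_comm₀ (Real.exp_pos _) (by norm_num), h2]
    nlinarith
  calc _ ≤ ‖((∑ A ∈ Fintype.piFinset fun _ : Fin n => Finset.Icc 1 n,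
        ∏ w, Real.cos (θ * (∑ i, foldStep s (z w).1 (z w).2 (A i) : ℤ) / 2) ^ 2 : ℝ) : ℂ)‖ := by
        rw [Complex.norm_real]
        exact Real.le_norm_self _
    _ ≤ ∑ τ ∈ Fintype.piFinset fun _ : Fin q => Finset.Icc (-1 : ℤ) 1,
        (n : ℝ) ^ n * ∏ w, (cosSqWeight (τ w) * if τ w = 0 then 1 else Real.exp (-2)) := by
        rw [hcomplex]
        exact (norm_sum_le _ _).trans (Finset.sum_le_sum hterm)
    _ = (n : ℝ) ^ n * (1 / 2 + 1 / 2 * Real.exp (-2)) ^ q := by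
        rw [← Finset.mul_sum, ← Finset.prod_univ_sum (fun _ : Fin q => Finset.Icc (-1 : ℤ) 1)
          (fun _ t => cosSqWeight t * if t = 0 then 1 else Real.exp (-2))]
        have h : Finset.Icc (-1 : ℤ) 1 = {-1, 0, 1} := by decide
        rw [h, Finset.prod_const, Finset.card_univ, Fintype.card_fin]
        congr 2
        simp [cosSqWeight]
        ring
    _ ≤ (n : ℝ) ^ n * (3 / 5) ^ q := by
        gcongr
        linarith

/-- Few sequences have a small spread at a given sum and frequency. -/
theorem card_spread_lt_le {n q T s : ℕ} {θ : ℝ} (hs : 6 * q * T < s) (hsn : s ≤ n) (hT0 : 0 < T)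
    (hθ : 0 ≤ Real.cos (2 * θ)) (hT : 1 ≤ T * (1 - Real.cos (2 * θ))) :
    (((Fintype.piFinset fun _ : Fin n => Finset.Icc 1 n).filter
        fun A => spread A s θ < (T : ℝ) ^ 2 / 10).card : ℝ) ≤ (n : ℝ) ^ n * (2 / 3) ^ q := by
  have hT0' : (0 : ℝ) < T := by exact_mod_cast hT0
  set I := Fintype.piFinset fun _ : Fin n => Finset.Icc 1 n
  set c : (Fin n → ℕ) → ℕ × ℕ → ℝ := fun A z =>
    Real.cos (θ * (∑ i, foldStep s z.1 z.2 (A i) : ℤ) / 2) ^ 2 with hc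
  have hcard : ∀ w, ((outerPairs T w).card : ℝ) = (T : ℝ) ^ 2 := by
    intro w
    rw [outerPairs, Finset.card_product, Nat.card_Ioc, Nat.card_Ioc,
      show 3 * w * T + T - 3 * w * T = T by omega,
      show 3 * w * T + 3 * T - (3 * w * T + 2 * T) = T by omega]
    push_cast; ring
  -- Each window's sum of `sin ^ 2` is part of the spread, so a small spread leaves nine tenths of
  -- the total in `cos ^ 2` for every window at once.
  have hprod : ∀ A ∈ I.filter fun A => spread A s θ < (T : ℝ) ^ 2 / 10,
      (9 / 10 * (T : ℝ) ^ 2) ^ q ≤ ∏ w : Fin q, ∑ z ∈ outerPairs T w, c A z := by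
    intro A hA
    have hA := (Finset.mem_filter.mp hA).2
    calc (9 / 10 * (T : ℝ) ^ 2) ^ q = ∏ _w : Fin q, (9 / 10 * (T : ℝ) ^ 2) := by simp
      _ ≤ _ := Finset.prod_le_prod (fun _ _ => by positivity) fun w _ => ?_
    have h1 : ∑ z ∈ outerPairs T w, c A z = (T : ℝ) ^ 2 - ∑ z ∈ outerPairs T w,
        Real.sin (θ * (∑ i, foldStep s z.1 z.2 (A i) : ℤ) / 2) ^ 2 := by
      simp_rw [hc, Real.cos_sq', Finset.sum_sub_distrib]
      simp [hcard]
    have h2 : ∑ z ∈ outerPairs T w,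
        Real.sin (θ * (∑ i, foldStep s z.1 z.2 (A i) : ℤ) / 2) ^ 2 ≤ spread A s θ := by
      rw [spread, ← Finset.sum_product']
      simp_rw [sum_foldStep]
      have := window_le (T := T) w.2
      have : 2 * (3 * q * T) < s := by linarith
      refine le_trans (le_of_eq (Finset.sum_congr rfl fun z _ => ?_))
        (Finset.sum_le_sum_of_subset_of_nonneg (s := outerPairs T w) ?_ fun _ _ _ => by positivity)
      · push_cast
        ring_nf
      · intro z hz
        simp only [outerPairs, Finset.mem_product, Finset.mem_Ioc, Finset.mem_Icc] at hz ⊢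
        omega
    linarith
  have htotal : ∑ A ∈ I, ∏ w : Fin q, ∑ z ∈ outerPairs T w, c A z ≤
      ((T : ℝ) ^ 2) ^ q * ((n : ℝ) ^ n * (3 / 5) ^ q) := by
    simp_rw [Finset.prod_univ_sum]
    rw [Finset.sum_comm]
    calc _ ≤ ∑ z ∈ Fintype.piFinset fun w : Fin q => outerPairs T w,
          ((n : ℝ) ^ n * (3 / 5) ^ q) := Finset.sum_le_sum fun z hz =>
            sum_prod_cos_sq_le hs hsn hθ hT fun w => Fintype.mem_piFinset.mp hz w
      _ = _ := by
          rw [Finset.sum_const, nsmul_eq_mul, Fintype.card_piFinset, Nat.cast_prod]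
          simp [hcard]
  have hle : ((I.filter fun A => spread A s θ < (T : ℝ) ^ 2 / 10).card : ℝ) *
      (9 / 10 * (T : ℝ) ^ 2) ^ q ≤ ((T : ℝ) ^ 2) ^ q * ((n : ℝ) ^ n * (3 / 5) ^ q) := by
    refine le_trans ?_ htotal
    rw [← nsmul_eq_mul, ← Finset.sum_const]
    refine (Finset.sum_le_sum hprod).trans
      (Finset.sum_le_sum_of_subset_of_nonneg (Finset.filter_subset _ _) fun A _ _ => ?_)
    exact Finset.prod_nonneg fun w _ => Finset.sum_nonneg fun z _ => by positivity
  have hpos : (0 : ℝ) < (9 / 10 * (T : ℝ) ^ 2) ^ q := by positivity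
  refine le_of_mul_le_mul_right (hle.trans (le_of_eq ?_)) hpos
  -- Markov's inequality: the ratio of the mean bound `3/5` to the threshold `9/10` is `2/3`.
  have : (3 / 5 : ℝ) = 2 / 3 * (9 / 10) := by norm_num
  rw [this, mul_pow, mul_pow]
  ring

theorem abs_sin_nat_mul_le (k : ℕ) (x : ℝ) : |Real.sin (k * x)| ≤ k * |Real.sin x| := by
  induction k with
  | zero => simp
  | succ k ih =>
    push_cast
    rw [add_mul, one_mul, Real.sin_add]
    calc _ ≤ |Real.sin (k * x)| * |Real.cos x| + |Real.cos (k * x)| * |Real.sin x| := by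
          rw [← abs_mul, ← abs_mul]
          exact abs_add_le _ _
      _ ≤ |Real.sin (k * x)| * 1 + 1 * |Real.sin x| := by
          gcongr
          · exact Real.abs_cos_le_one _
          · exact Real.abs_cos_le_one _
      _ ≤ _ := by linarith

theorem spread_nat_mul_le {n : ℕ} (A : Fin n → ℕ) (s k : ℕ) (θ : ℝ) :
    spread A s (k * θ) ≤ k ^ 2 * spread A s θ := by
  simp only [spread, Finset.mul_sum]
  refine Finset.sum_le_sum fun x _ => Finset.sum_le_sum fun y _ => ?_
  rw [← mul_pow]
  apply sq_le_sq.mpr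
  rw [abs_mul, Nat.abs_cast]
  refine le_trans (le_of_eq ?_) (abs_sin_nat_mul_le k _)
  congr 2
  ring

/-! ### Uniformity in the sum and the frequency -/

/-- The spread of `A` is as large as expected at all sums and at all frequencies `m π / (8 n)` that
are not too small. -/
def IsSpreadOut {n : ℕ} (T : ℕ) (A : Fin n → ℕ) : Prop :=
  ∀ s ∈ Finset.Ioc (n / 2) n, ∀ m ∈ Finset.range n, 8 * n ^ 2 ≤ m ^ 2 * T →
    (T : ℝ) ^ 2 / 10 ≤ spread A s (m * (Real.pi / (8 * n)))

open Classical in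
-- A union bound over at most `n ^ 2` pairs `(s, m)`. The condition `8 * n ^ 2 ≤ m ^ 2 * T` yields
-- `1 ≤ T * (1 - cos (2 θ))` through `sin θ ≥ 2 θ / π`, and `θ ≤ π / 8` keeps `cos (2 θ)`
-- nonnegative.
theorem card_not_isSpreadOut_le {n q T : ℕ} (hqT : 12 * (q * T) ≤ n) (hT : 0 < T) :
    (((Fintype.piFinset fun _ : Fin n => Finset.Icc 1 n).filter
        fun A => ¬ IsSpreadOut T A).card : ℝ) ≤ n * (n * ((n : ℝ) ^ n * (2 / 3) ^ q)) := by
  set I := Fintype.piFinset fun _ : Fin n => Finset.Icc 1 n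
  set Q := (Finset.Ioc (n / 2) n ×ˢ Finset.range n).filter fun p => 8 * n ^ 2 ≤ p.2 ^ 2 * T
  have hsub : (I.filter fun A => ¬ IsSpreadOut T A) ⊆ Q.biUnion fun p =>
      I.filter fun A => spread A p.1 (p.2 * (Real.pi / (8 * n))) < (T : ℝ) ^ 2 / 10 := by
    intro A hA
    obtain ⟨hAI, hA⟩ := Finset.mem_filter.mp hA
    simp only [IsSpreadOut, not_forall, not_le] at hA
    obtain ⟨s, hs, m, hm, h, hlt⟩ := hA
    exact Finset.mem_biUnion.mpr ⟨(s, m), Finset.mem_filter.mpr ⟨Finset.mk_mem_product hs hm, h⟩,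
      Finset.mem_filter.mpr ⟨hAI, hlt⟩⟩
  have hQ : Q.card ≤ n * n := by
    refine (Finset.card_filter_le _ _).trans ?_
    rw [Finset.card_product, Nat.card_Ioc, Finset.card_range]
    exact Nat.mul_le_mul_right _ (Nat.sub_le _ _)
  have hone : ∀ p ∈ Q, ((I.filter fun A =>
      spread A p.1 (p.2 * (Real.pi / (8 * n))) < (T : ℝ) ^ 2 / 10).card : ℝ) ≤
      (n : ℝ) ^ n * (2 / 3) ^ q := by
    rintro ⟨s, m⟩ hp
    simp only [Q, Finset.mem_filter, Finset.mem_product, Finset.mem_Ioc, Finset.mem_range] at hp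
    obtain ⟨⟨⟨hs1, hs2⟩, hm⟩, hmT⟩ := hp
    have hn' : (0 : ℝ) < n := by exact_mod_cast (by omega : 0 < n)
    have hmn : (m : ℝ) ≤ n := by exact_mod_cast hm.le
    have hpi := Real.pi_pos
    have hθ : (m : ℝ) * (Real.pi / (8 * n)) ≤ Real.pi / 8 := by
      rw [mul_div_assoc', div_le_div_iff₀ (by positivity) (by norm_num)]
      nlinarith
    have hθ0 : 0 ≤ (m : ℝ) * (Real.pi / (8 * n)) := by positivity
    refine card_spread_lt_le ?_ hs2 hT ?_ ?_
    · rw [mul_assoc]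
      omega
    · exact Real.cos_nonneg_of_neg_pi_div_two_le_of_le (by linarith) (by linarith)
    · have h1 := Real.mul_le_sin hθ0 (by linarith)
      have h2 : 2 / Real.pi * (m * (Real.pi / (8 * n))) = m / (4 * n) := by
        field_simp; ring
      rw [h2] at h1
      have h3 : (m / (4 * n) : ℝ) ^ 2 ≤ Real.sin (m * (Real.pi / (8 * n))) ^ 2 := by gcongr
      have h4 : (8 * n ^ 2 : ℝ) ≤ m ^ 2 * T := by exact_mod_cast hmT
      rw [Real.cos_two_mul, Real.cos_sq']
      calc (1 : ℝ) ≤ T * (2 * (m / (4 * n)) ^ 2) := by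
            rw [div_pow, mul_div_assoc', mul_div_assoc', le_div_iff₀ (by positivity)]
            nlinarith
        _ ≤ T * (2 * Real.sin (m * (Real.pi / (8 * n))) ^ 2) := by gcongr
        _ = _ := by ring
  calc _ ≤ ((Q.biUnion fun p => I.filter fun A =>
        spread A p.1 (p.2 * (Real.pi / (8 * n))) < (T : ℝ) ^ 2 / 10).card : ℝ) := by
        exact_mod_cast Finset.card_le_card hsub
    _ ≤ ∑ p ∈ Q, ((I.filter fun A =>
        spread A p.1 (p.2 * (Real.pi / (8 * n))) < (T : ℝ) ^ 2 / 10).card : ℝ) := by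
        exact_mod_cast Finset.card_biUnion_le
    _ ≤ ∑ _p ∈ Q, (n : ℝ) ^ n * (2 / 3) ^ q := Finset.sum_le_sum hone
    _ ≤ ((n * n : ℕ) : ℝ) * ((n : ℝ) ^ n * (2 / 3) ^ q) := by
        rw [Finset.sum_const, nsmul_eq_mul]
        gcongr
    _ = _ := by push_cast; ring

/-- Small frequencies are handled by passing to a multiple. -/
theorem IsSpreadOut.le_spread {n T L : ℕ} {A : Fin n → ℕ} (hA : IsSpreadOut T A) (hT : 32 ≤ T)
    (hL : 0 < L) (h1 : 120 * n * Real.log n ≤ (T : ℝ) ^ 2)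
    (h2 : 3840 * n ^ 3 * Real.log n ≤ (T : ℝ) ^ 3 * L ^ 2) {s m : ℕ} (hs1 : n / 2 < s)
    (hs2 : s ≤ n) (hm1 : L ≤ m) (hm2 : m < n) :
    12 * n * Real.log n ≤ spread A s (m * (Real.pi / (8 * n))) := by
  classical
  have hn : 0 < n := by omega
  have hn' : (0 : ℝ) < n := by exact_mod_cast hn
  have hm0 : 0 < m := by omega
  have hm' : (0 : ℝ) < m := by exact_mod_cast hm0
  have hT' : (0 : ℝ) < T := by exact_mod_cast (by omega : 0 < T)
  have hlog : 0 ≤ Real.log n := Real.log_natCast_nonneg n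
  have hex : ∃ k : ℕ, 8 * n ^ 2 ≤ (k * m) ^ 2 * T := by
    refine ⟨n, ?_⟩
    calc 8 * n ^ 2 ≤ n ^ 2 * 32 := by omega
      _ ≤ (n * m) ^ 2 * T := by
        gcongr
        exact Nat.le_mul_of_pos_right n hm0
  -- Minimality of `k` keeps `k * m` within a factor two of the threshold (unless `k = 1`), so `k *
  -- m < n` and the loss `k ^ 2` in the spread is affordable.
  set k := Nat.find hex
  have hk : 8 * n ^ 2 ≤ (k * m) ^ 2 * T := Nat.find_spec hex
  have hk0 : k ≠ 0 := by
    intro h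
    rw [h] at hk
    have := pow_pos hn 2
    simp at hk
    omega
  have hmul : k * m < n ∧ 120 * n * Real.log n * k ^ 2 ≤ (T : ℝ) ^ 2 := by
    by_cases hk1 : k = 1
    · rw [hk1]
      simpa [hm2] using h1
    · have hlt : ((k - 1) * m) ^ 2 * T < 8 * n ^ 2 :=
        not_le.mp (Nat.find_min hex (show k - 1 < k by omega))
      have hkm : (k * m) ^ 2 * T < 32 * n ^ 2 := by
        have : k * m ≤ 2 * ((k - 1) * m) := by
          rw [← mul_assoc]
          exact Nat.mul_le_mul_right _ (by omega)
        calc (k * m) ^ 2 * T ≤ (2 * ((k - 1) * m)) ^ 2 * T := by gcongr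
          _ = 4 * (((k - 1) * m) ^ 2 * T) := by ring
          _ < _ := by omega
      constructor
      · refine lt_of_pow_lt_pow_left₀ 2 (Nat.zero_le _) ?_
        have : (k * m) ^ 2 * 32 ≤ (k * m) ^ 2 * T := Nat.mul_le_mul_left _ hT
        omega
      · have hkm' : ((k : ℝ) * m) ^ 2 * T ≤ 32 * n ^ 2 := by exact_mod_cast hkm.le
        have hLm : (T : ℝ) ^ 3 * L ^ 2 ≤ T ^ 3 * m ^ 2 := by gcongr
        have hpos : (0 : ℝ) < m ^ 2 * T := by positivity
        refine le_of_mul_le_mul_right ?_ hpos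
        calc 120 * n * Real.log n * k ^ 2 * (m ^ 2 * T)
            = 120 * n * Real.log n * ((k * m) ^ 2 * T) := by ring
          _ ≤ 120 * n * Real.log n * (32 * n ^ 2) := by gcongr
          _ = 3840 * n ^ 3 * Real.log n := by ring
          _ ≤ T ^ 3 * m ^ 2 := h2.trans hLm
          _ = _ := by ring
  have hbig := hA s (Finset.mem_Ioc.mpr ⟨hs1, hs2⟩) (k * m) (Finset.mem_range.mpr hmul.1) hk
  rw [Nat.cast_mul, mul_assoc] at hbig
  have := hbig.trans (spread_nat_mul_le A s k _)
  have hk' : (0 : ℝ) < (k : ℝ) ^ 2 := by positivity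
  refine le_of_mul_le_mul_left ?_ hk'
  linarith [hmul.2]

/-! ### Choice of parameters and conclusion -/

theorem diceMeasure_real_apply (n : ℕ) (E : Set (Fin n → ℕ)) :
    (diceMeasure n).real E = ((dice n : Set (Fin n → ℕ)) ∩ E).ncard / (dice n).card := by
  classical
  have h : (dice n : Set (Fin n → ℕ)) ∩ E = ((dice n).filter fun a => a ∈ E : Finset _) := by
    ext; simp
  rw [Measure.real, diceMeasure, ← uniformOn_inter_self (Finset.finite_toSet _), h,
    uniformOn_apply_finset, Set.ncard_coe_finset,
    Finset.inter_eq_right.mpr (Finset.filter_subset _ _)]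
  simp

theorem isProbabilityMeasure_diceMeasure {n : ℕ} (hn : 0 < n) :
    IsProbabilityMeasure (diceMeasure n) :=
  isProbabilityMeasure_uniformOn (Finset.finite_toSet _) (dice_nonempty hn)

/-- Choice of the parameters: `q` windows of length `3 T`, and frequencies from `L` on. -/
theorem exists_parameters : ∃ n₀ : ℕ, ∀ n ≥ n₀, 1 ≤ Real.log n ∧ ∃ q T L : ℕ,
    12 * (q * T) ≤ n ∧ 32 ≤ T ∧ 0 < L ∧ 120 * n * Real.log n ≤ (T : ℝ) ^ 2 ∧
    3840 * n ^ 3 * Real.log n ≤ (T : ℝ) ^ 3 * L ^ 2 ∧ (2 / 3 : ℝ) ^ q ≤ ((n : ℝ) ^ 9)⁻¹ ∧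
    (L : ℝ) ≤ 2000000 * Real.log n ^ 2 + 1 := by
  have h1 : ∀ᶠ n : ℕ in atTop, 60000000 * Real.log n ^ 3 ≤ n := by
    have := (Real.isLittleO_pow_log_id_atTop (n := 3)).comp_tendsto tendsto_natCast_atTop_atTop
    filter_upwards [this.bound (by norm_num : (0 : ℝ) < 1 / 60000000)] with n hn
    simp only [Function.comp, id, norm_pow, Real.norm_eq_abs, Nat.abs_cast] at hn
    rw [← abs_pow] at hn
    have := le_abs_self (Real.log n ^ 3)
    linarith
  have h2 : ∀ᶠ n : ℕ in atTop, 1 ≤ Real.log n :=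
    (Real.tendsto_log_atTop.comp tendsto_natCast_atTop_atTop).eventually_ge_atTop 1
  obtain ⟨n₀, h⟩ := eventually_atTop.mp (h1.and h2)
  refine ⟨n₀, fun n hn => ?_⟩
  obtain ⟨hbig, hlog⟩ := h n hn
  refine ⟨hlog, ?_⟩
  set l := Real.log n
  have hl2 : l ≤ l ^ 2 := by nlinarith
  have hl3 : l ^ 2 ≤ l ^ 3 := by nlinarith [sq_nonneg l]
  have hnpos : (0 : ℝ) < n := by nlinarith
  -- Since `2 / 3 ≤ exp (-1 / 3)`, the factor `27` gives `(2 / 3) ^ q ≤ n ^ (-9)`.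
  have hq := Nat.le_ceil (27 * l)
  have hq' := Nat.ceil_lt_add_one (show 0 ≤ 27 * l by linarith)
  set q := ⌈27 * l⌉₊
  have hq0 : (0 : ℝ) < q := by linarith
  set T := n / (12 * q)
  have hTle : 12 * (q * T) ≤ n := by
    rw [← mul_assoc]
    exact Nat.mul_div_le n (12 * q)
  have hTlow : (n : ℝ) / (672 * l) ≤ T := by
    have h3 : (n : ℝ) / (12 * q) < T + 1 := by
      have := Nat.lt_floor_add_one ((n : ℝ) / ((12 * q : ℕ) : ℝ))
      rw [Nat.floor_div_eq_div] at this
      exact_mod_cast this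
    have h4 : (n : ℝ) / (336 * l) ≤ n / (12 * q) :=
      div_le_div_of_nonneg_left hnpos.le (by positivity) (by linarith)
    have h5 : (n : ℝ) / (336 * l) = 2 * (n / (672 * l)) := by field_simp; norm_num
    have h6 : 1 ≤ (n : ℝ) / (672 * l) := by
      rw [le_div_iff₀ (by positivity)]
      linarith
    linarith
  have hLlow := Nat.le_ceil (2000000 * l ^ 2)
  have hLup := Nat.ceil_lt_add_one (show 0 ≤ 2000000 * l ^ 2 by positivity)
  refine ⟨q, T, ⌈2000000 * l ^ 2⌉₊, hTle, ?_, ?_, ?_, ?_, ?_, hLup.le⟩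
  · have : (32 : ℝ) ≤ T := by
      refine le_trans ?_ hTlow
      rw [le_div_iff₀ (by positivity)]
      linarith
    exact_mod_cast this
  · exact Nat.ceil_pos.mpr (by positivity)
  · calc 120 * n * l ≤ (n / (672 * l)) ^ 2 := by
          rw [div_pow, le_div_iff₀ (by positivity)]
          have := mul_le_mul_of_nonneg_left hbig hnpos.le
          nlinarith [mul_pos hnpos (show 0 < l ^ 3 by positivity)]
      _ ≤ T ^ 2 := by gcongr
  · calc 3840 * n ^ 3 * l ≤ (n / (672 * l)) ^ 3 * (2000000 * l ^ 2) ^ 2 := by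
          have : (n / (672 * l)) ^ 3 * (2000000 * l ^ 2) ^ 2 =
              (2000000 ^ 2 / 672 ^ 3) * (n ^ 3 * l) := by field_simp
          rw [this, mul_assoc]
          gcongr
          norm_num
      _ ≤ _ := by gcongr
  · have h3 : (2 / 3 : ℝ) ≤ Real.exp (-(1 / 3)) := by
      have := Real.add_one_le_exp (-(1 / 3) : ℝ)
      linarith
    calc (2 / 3 : ℝ) ^ q ≤ Real.exp (-(1 / 3)) ^ q := by gcongr
      _ = Real.exp (-(q / 3)) := by rw [← Real.exp_nat_mul]; congr 1; ring
      _ ≤ Real.exp (-(9 * l)) := by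
          apply Real.exp_le_exp.mpr
          linarith
      _ = ((n : ℝ) ^ 9)⁻¹ := by
          rw [Real.exp_neg, mul_comm, Real.exp_mul, Real.exp_log hnpos]
          norm_cast

theorem exists_ties_bound : ∃ n₀ : ℕ, ∀ n ≥ n₀, 1 ≤ n →
    (diceMeasure n).real
        {A : Fin n → ℕ | 5000000 * (Real.log n ^ (5 / 2 : ℝ) / n) <
          (diceMeasure n).real {B : Fin n → ℕ | Ties A B}} ≤ 1 / (n : ℝ) ^ 5 := by
  classical
  obtain ⟨n₀, h⟩ := exists_parameters
  refine ⟨n₀, fun n hn hn1 => ?_⟩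
  obtain ⟨hlog, q, T, L, hqT, hT, hL, h1, h2, hq, hLup⟩ := h n hn
  have hn' : (0 : ℝ) < n := by exact_mod_cast hn1
  have hcard : (0 : ℝ) < (dice n).card := by exact_mod_cast (dice_nonempty hn1).card_pos
  have hgood : ∀ A : Fin n → ℕ, IsSpreadOut T A →
      (diceMeasure n).real {B : Fin n → ℕ | Ties A B} ≤
        5000000 * (Real.log n ^ (5 / 2 : ℝ) / n) := by
    intro A hA
    have h3 := card_ties_le A (L := L) (ω := Real.pi / (8 * n)) hn1
      fun s hs1 hs2 m hm1 hm2 => hA.le_spread hT hL h1 h2 hs1 hs2 hm1 hm2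
    rw [diceMeasure_real_apply, div_le_iff₀ hcard, mul_comm]
    refine h3.trans ?_
    gcongr
    rw [mul_div_assoc']
    gcongr
    -- The argument yields exponent `2`; it is weakened to `5 / 2` using `1 ≤ log n`.
    have h4 : Real.log n ^ 2 ≤ Real.log n ^ (5 / 2 : ℝ) := by
      rw [← Real.rpow_natCast]
      exact Real.rpow_le_rpow_of_exponent_le hlog (by norm_num)
    nlinarith
  have hsub : ((dice n : Set (Fin n → ℕ)) ∩ {A | 5000000 * (Real.log n ^ (5 / 2 : ℝ) / n) <
      (diceMeasure n).real {B : Fin n → ℕ | Ties A B}}) ⊆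
      (((Fintype.piFinset fun _ : Fin n => Finset.Icc 1 n).filter
        fun A => ¬ IsSpreadOut T A : Finset (Fin n → ℕ)) : Set (Fin n → ℕ)) := by
    rintro A ⟨hA, hlt⟩
    exact Finset.mem_coe.mpr (Finset.mem_filter.mpr ⟨(Finset.mem_filter.mp hA).1,
      fun hs => absurd (hgood A hs) (not_le.mpr hlt)⟩)
  have hbad := Set.ncard_le_ncard hsub (Finset.finite_toSet _)
  rw [Set.ncard_coe_finset] at hbad
  have hdice : (n : ℝ) ^ n ≤ n * (n * (dice n).card) := by
    exact_mod_cast pow_le_sq_mul_card_dice hn1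
  rw [diceMeasure_real_apply, div_le_iff₀ hcard]
  calc _ ≤ (n : ℝ) * (n * ((n : ℝ) ^ n * (2 / 3) ^ q)) :=
        (Nat.cast_le.mpr hbad).trans (card_not_isSpreadOut_le hqT (by omega))
    _ ≤ n * (n * ((n * (n * (dice n).card)) * ((n : ℝ) ^ 9)⁻¹)) := by gcongr
    _ = 1 / (n : ℝ) ^ 5 * (dice n).card := by field_simp

theorem prod_real_le {Ω : Type*} [MeasurableSpace Ω] (μ : Measure Ω) [IsProbabilityMeasure μ]
    {R : Set (Ω × Ω)} (hR : MeasurableSet R) {t : ℝ} (ht : 0 ≤ t)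
    (hbad : MeasurableSet {x | t < μ.real (Prod.mk x ⁻¹' R)}) :
    (μ.prod μ).real R ≤ μ.real {x | t < μ.real (Prod.mk x ⁻¹' R)} + t := by
  set bad := {x | t < μ.real (Prod.mk x ⁻¹' R)}
  have h : (μ.prod μ) R ≤ μ bad + ENNReal.ofReal t := by
    rw [Measure.prod_apply hR]
    calc _ ≤ ∫⁻ x, (bad.indicator 1 x + ENNReal.ofReal t) ∂μ := by
          refine lintegral_mono fun x => ?_
          by_cases hx : x ∈ bad
          · simp only [Set.indicator_of_mem hx, Pi.one_apply]
            exact prob_le_one.trans le_self_add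
          · rw [Set.indicator_of_notMem hx, zero_add]
            exact ENNReal.le_ofReal_iff_toReal_le (measure_ne_top _ _) ht |>.mpr (not_lt.mp hx)
      _ = μ bad + ENNReal.ofReal t := by
          rw [lintegral_add_right _ measurable_const, lintegral_indicator_one hbad]
          simp
  have := ENNReal.toReal_mono (by finiteness) h
  rwa [ENNReal.toReal_add (measure_ne_top _ _) ENNReal.ofReal_ne_top, ENNReal.toReal_ofReal ht]
    at this

theorem theorem1p4 :
    Tendsto
      (fun n : ℕ => ((diceMeasure n).prod (diceMeasure n)).real
        {p : (Fin n → ℕ) × (Fin n → ℕ) | Ties p.1 p.2})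
      atTop (𝓝 0) ∧
    ∃ C₁ C₂ : ℝ, 0 < C₁ ∧ 0 < C₂ ∧ ∀ n : ℕ, 1 ≤ n →
      (diceMeasure n).real
        {A : Fin n → ℕ |
          C₂ * (Real.log n ^ (5 / 2 : ℝ) / n) < (diceMeasure n).real {B : Fin n → ℕ | Ties A B}} ≤
        C₁ / (n : ℝ) ^ 5 := by
  obtain ⟨n₀, h⟩ := exists_ties_bound
  constructor
  · have hlim : Tendsto (fun n : ℕ => 1 / (n : ℝ) ^ 5 +
        5000000 * (Real.log n ^ (5 / 2 : ℝ) / n)) atTop (𝓝 0) := by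
      have h1 : Tendsto (fun n : ℕ => 1 / (n : ℝ) ^ 5) atTop (𝓝 0) := by
        have := ((tendsto_pow_atTop (by norm_num : (5 : ℕ) ≠ 0)).comp
          (tendsto_natCast_atTop_atTop (R := ℝ))).inv_tendsto_atTop
        simpa [Function.comp_def, Pi.inv_def] using this
      have h2 : Tendsto (fun n : ℕ => Real.log n ^ (5 / 2 : ℝ) / n) atTop (𝓝 0) := by
        have := ((isLittleO_log_rpow_rpow_atTop (5 / 2) one_pos).tendsto_div_nhds_zero).comp
          (tendsto_natCast_atTop_atTop (R := ℝ))
        simpa [Function.comp_def] using this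
      simpa using h1.add (h2.const_mul 5000000)
    refine tendsto_of_tendsto_of_tendsto_of_le_of_le' tendsto_const_nhds hlim
      (Eventually.of_forall fun n => measureReal_nonneg) ?_
    filter_upwards [eventually_ge_atTop n₀, eventually_ge_atTop 1] with n hn hn1
    have := isProbabilityMeasure_diceMeasure hn1
    refine (prod_real_le (diceMeasure n) (Set.to_countable _).measurableSet
      (t := 5000000 * (Real.log n ^ (5 / 2 : ℝ) / n)) ?_ (Set.to_countable _).measurableSet).trans
      (add_le_add_left (h n hn hn1) _)
    have := Real.log_natCast_nonneg n
    positivity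
  -- This `C₁` makes the bound at least `1`, hence trivial, for `n < n₀`.
  · refine ⟨((n₀ + 1 : ℕ) : ℝ) ^ 5, 5000000, by positivity, by norm_num, fun n hn1 => ?_⟩
    have hn' : (0 : ℝ) < n := by exact_mod_cast hn1
    rcases le_or_gt n₀ n with hn | hn
    · refine (h n hn hn1).trans ?_
      gcongr
      exact one_le_pow₀ (by exact_mod_cast Nat.le_add_left 1 n₀)
    · have := isProbabilityMeasure_diceMeasure hn1
      refine measureReal_le_one.trans ?_
      rw [one_le_div (by positivity)]
      gcongr
      omega
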